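/- Consider the Black--Scholes market on $[0,T]$, $T>0$: on a complete probability space $(\Omega,\mathcal F,\mathbb P)$ let $W$ be a standard Brownian motion with augmented filtration $\mathcal F_t=\sigma\{W_s: s\le t\}\vee\mathcal N(\mathbb P)$, where $\mathcal N(\mathbb P)$ is the family of $\mathbb P$-null events; the bond is $e^{rt}$, and the stock is $S_t=\exp\big((\mu-\tfrac{\sigma^2}{2})t+\sigma W_t\big)$, with $r\in\mathbb R$, $\mu>r$ and $\sigma>0$. Put $\theta=(\mu-r)/\sigma$, let $\alpha>0$ and $\tilde X_0,K_l\in\mathbb R$, and let the shadow wealth be the optimal wealth process for the utility $-e^{-\alpha x}$ with initial value $\tilde X_0$, $$\tilde X_t=\tilde X_0e^{rt}+t\,\frac{\theta^2}{\alpha}e^{r(t-T)}+\frac{\theta}{\alpha}e^{r(t-T)}W_t .$$ A risk-neutral measure is a probability measure $\mathbb Q$ equivalent to $\mathbb P$ under which $W_t+\theta t$, $t\in[0,T]$, is a standard Brownian motion and $e^{-rt}S_t$, $t\in[0,T]$, is an $(\mathcal F_t)$-martingale. Such a measure exists. For every such $\mathbb Q$ the put payoff $(K_l-\tilde X_T)^+$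 is $\mathbb Q$-integrable, and for every $t\in[0,T)$ its risk-neutral price at time $t$ is, almost surely, $$e^{-r(T-t)}\,\mathbb E_{\mathbb Q}\big[(K_l-\tilde X_T)^+\,\big|\,\mathcal F_t\big]=p(t,\tilde X_t),$$ where $$p(t,x)=\Phi(d_l)\big(e^{-r(T-t)}K_l-x\big)+\frac{\theta\sqrt{T-t}}{\alpha}e^{-r(T-t)}\varphi(d_l),\qquad d_l=d_l(t,x)=\big(K_l-xe^{r(T-t)}\big)\frac{\alpha}{\theta\sqrt{T-t}},$$ and $\Phi$ and $\varphi$ are the standard normal distribution function and density. At $t=T$ the price is $(K_l-\tilde X_T)^+$ almost surely, and this is the formula in the limit: for every $x\in\mathbb R$, $p(t,y)\to(K_l-x)^+$ as $t\uparrow T$ and $y\to x$. -/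

import Mathlib

open MeasureTheory ProbabilityTheory Filter Topology
open scoped NNReal

namespace ShadowPut

noncomputable section

/-- The market price of risk `θ = (μ - r) / σ`. -/
def marketPriceOfRisk (r μ σ : ℝ) : ℝ := (μ - r) / σ

/-- The stock price of the Black-Scholes model, i.e. the geometric Brownian motion with
`dS = μ S dt + σ S dW` and `S 0 = 1`. -/
def stock {Ω : Type*} (W : ℝ≥0 → Ω → ℝ) (μ σ : ℝ) (t : ℝ≥0) (ω : Ω) : ℝ :=
  Real.exp ((μ - σ ^ 2 / 2) * t + σ * W t ω)

/-- The shadow wealth process: the wealth process, started from `x₀`, of the strategy that is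
optimal for the utility `x ↦ - exp (-α x)` at the horizon `T`,
`x₀ e^{rt} + t (θ² / α) e^{r(t-T)} + (θ / α) e^{r(t-T)} W_t`. -/
def shadowWealth {Ω : Type*} (W : ℝ≥0 → Ω → ℝ) (r θ α x₀ : ℝ) (T t : ℝ≥0) (ω : Ω) : ℝ :=
  x₀ * Real.exp (r * t) + t * (θ ^ 2 / α) * Real.exp (r * (t - T))
    + θ / α * Real.exp (r * (t - T)) * W t ω

/-- The augmented Brownian filtration `F_t = σ(W_s, s ≤ t) ∨ N(P)`, where `N(P)` is the family
of `P`-null events. -/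
def brownianFiltration {Ω : Type*} {m : MeasurableSpace Ω} (P : Measure Ω) [P.IsComplete]
    (W : ℝ≥0 → Ω → ℝ) (hW : ∀ t, Measurable (W t)) : Filtration ℝ≥0 m where
  seq t := (⨆ s ≤ t, MeasurableSpace.comap (W s) inferInstance) ⊔
    MeasurableSpace.generateFrom {N : Set Ω | P N = 0}
  mono' _ _ hst := sup_le_sup_right (biSup_mono fun _ hu => hu.trans hst) _
  le' t := by
    refine sup_le (iSup₂_le fun s _ => (hW s).comap_le) ?_
    exact MeasurableSpace.generateFrom_le fun N hN => Measure.IsComplete.out' N hN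

/-- `B` is a standard Brownian motion on the time interval `[0, T]` under `Q`: it has the
finite-dimensional laws of Brownian motion (centred Gaussian with covariance `min s t`) at times
in `[0, T]`, and almost surely its paths are continuous on `[0, T]`. -/
structure IsBrownianOn {Ω : Type*} {m : MeasurableSpace Ω} (B : ℝ≥0 → Ω → ℝ) (T : ℝ≥0)
    (Q : Measure Ω) : Prop where
  hasLaw : ∀ I : Finset ℝ≥0, (∀ t ∈ I, t ≤ T) →
    HasLaw (fun ω => I.restrict (B · ω)) (BrownianReal.projectiveFamily I) Q
  cont : ∀ᵐ ω ∂Q, ContinuousOn (B · ω) (Set.Iic T)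

/-- `X` is a martingale on the time interval `[0, T]` with respect to `F` under `Q`. -/
structure IsMartingaleOn {Ω : Type*} {m : MeasurableSpace Ω} (X : ℝ≥0 → Ω → ℝ)
    (F : Filtration ℝ≥0 m) (T : ℝ≥0) (Q : Measure Ω) : Prop where
  adapted : ∀ t ≤ T, StronglyMeasurable[F t] (X t)
  integrable : ∀ t ≤ T, Integrable (X t) Q
  condExp_eq : ∀ s t, s ≤ t → t ≤ T → Q[X t | F s] =ᵐ[Q] X s

/-- `Q` is a risk-neutral measure of the Black-Scholes market on `[0, T]`: a probability measure
equivalent to `P` under which `W_t + θ t` is a standard Brownian motion and the discounted stock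
price is a martingale. -/
structure IsRiskNeutral {Ω : Type*} {m : MeasurableSpace Ω} (P : Measure Ω)
    (F : Filtration ℝ≥0 m) (W : ℝ≥0 → Ω → ℝ) (r μ σ : ℝ) (T : ℝ≥0) (Q : Measure Ω) : Prop where
  isProbabilityMeasure : IsProbabilityMeasure Q
  ac : Q ≪ P
  ac_symm : P ≪ Q
  isBrownianOn : IsBrownianOn (fun t ω => W t ω + marketPriceOfRisk r μ σ * t) T Q
  isMartingaleOn :
    IsMartingaleOn (fun t ω => Real.exp (-(r * t)) * stock W μ σ t ω) F T Q

/-- The payoff of the put with strike `K` on the terminal value `X_T`. -/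
def putPayoff {Ω : Type*} (X : ℝ≥0 → Ω → ℝ) (K : ℝ) (T : ℝ≥0) (ω : Ω) : ℝ :=
  max (K - X T ω) 0

/-- The risk-neutral price under `Q`, at time `t`, of a claim paid at time `T`:
`e^{-r(T-t)} E_Q[claim | F_t]`. -/
def riskNeutralPrice {Ω : Type*} {m : MeasurableSpace Ω} (Q : Measure Ω)
    (F : Filtration ℝ≥0 m) (r : ℝ) (T : ℝ≥0) (claim : Ω → ℝ) (t : ℝ≥0) (ω : Ω) : ℝ :=
  Real.exp (-(r * (T - t))) * (Q[claim | F t]) ω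

/-- The standard normal distribution function `Φ`. -/
def stdNormalCDF (x : ℝ) : ℝ := cdf (gaussianReal 0 1) x

/-- The standard normal density `φ`. -/
def stdNormalPDF (x : ℝ) : ℝ := gaussianPDFReal 0 1 x

/-- `d_l(t, x) = (K - x e^{r(T-t)}) α / (√(T-t) θ)`, meant for `t < T`. -/
def dLower (r θ α K T t x : ℝ) : ℝ :=
  (K - x * Real.exp (r * (T - t))) * (α / (√(T - t) * θ))

/-- `p(t, x) = Φ(d_l) (e^{-r(T-t)} K - x) + (θ √(T-t) / α) e^{-r(T-t)} φ(d_l)`, meant for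
`t < T`. -/
def putFormula (r θ α K T t x : ℝ) : ℝ :=
  stdNormalCDF (dLower r θ α K T t x) * (Real.exp (-(r * (T - t))) * K - x)
    + θ * √(T - t) / α * Real.exp (-(r * (T - t))) * stdNormalPDF (dLower r θ α K T t x)

end

end ShadowPut

/-! Under a risk-neutral measure, `B_t = W_t + θ t` is a Brownian motion, and the discounted shadow
wealth is `x₀ + (θ/α) e^{-rT} B_t`: a Bachelier model. Hence `X_T = e^{r(T-t)} X_t + (θ/α)(B_T -
B_t)`, where the increment is centred Gaussian with variance `T - t` and independent of `F_t`, null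
sets included. The freezing lemma `condExp_comp_prod_of_indep` turns the price into a discounted
integral of `(a - s z)^+` against the standard normal law, with `a = K - X_t e^{r(T-t)}` and `s = θ
√(T-t) / α`; `integral_max_sub_mul_gaussianReal` evaluates it. The limit at maturity follows from
the same integral, because the payoff is 1-Lipschitz.

Existence of the measure needs no stochastic calculus. The Girsanov density depends on the path only
through `W_T`, and the path is a bridge independent of `W_T` plus `(t/T) W_T`. Adding the drift `θ
t` moves `W_T` by `θ T` and leaves the bridge alone, so Cameron-Martin reduces to tilting a
one-dimensional Gaussian. -/

namespace ShadowPut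

/-! ### Gaussian integrals: the Bachelier formula and its limit at maturity. -/

theorem hasDerivAt_stdNormalPDF (z : ℝ) :
    HasDerivAt stdNormalPDF (-(z * stdNormalPDF z)) z := by
  have h : stdNormalPDF = fun z => (√(2 * Real.pi))⁻¹ * Real.exp (-z ^ 2 / 2) := by
    ext z; simp [stdNormalPDF, gaussianPDFReal]
  rw [h]
  have h1 : HasDerivAt (fun z : ℝ => -z ^ 2 / 2) (-z) z := by
    have := ((hasDerivAt_pow 2 z).neg).div_const 2
    convert! this using 1
    simp; ring
  convert! (h1.exp.const_mul (√(2 * Real.pi))⁻¹) using 1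
  ring

theorem tendsto_stdNormalPDF_atBot : Tendsto stdNormalPDF atBot (𝓝 0) := by
  have h : stdNormalPDF = fun z => (√(2 * Real.pi))⁻¹ * Real.exp (-(z ^ 2 / 2)) := by
    ext z; simp [stdNormalPDF, gaussianPDFReal, neg_div]
  rw [h]
  have h2 : Tendsto (fun z : ℝ => z ^ 2 / 2) atBot atTop :=
    Tendsto.atTop_div_const (by norm_num) (by
      simpa [Function.comp_def] using
        (tendsto_pow_atTop (α := ℝ) two_ne_zero).comp tendsto_abs_atBot_atTop)
  have := (Real.tendsto_exp_atBot.comp (tendsto_neg_atTop_atBot.comp h2)).const_mul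
    (√(2 * Real.pi))⁻¹
  simpa using this

theorem integrable_max_sub_mul (ν : Measure ℝ) [IsFiniteMeasure ν]
    (hν : Integrable (fun z : ℝ => z) ν)
    (a s : ℝ) : Integrable (fun z => max (a - s * z) 0) ν :=
  ((integrable_const a).sub (hν.const_mul s)).pos_part

theorem integrable_fun_id_gaussianReal (m : ℝ) (v : ℝ≥0) :
    Integrable (fun z : ℝ => z) (gaussianReal m v) :=
  (memLp_id_gaussianReal (μ := m) (v := v) 1).integrable le_rfl

/-- The Bachelier formula for the expected payoff of a put. -/
theorem integral_max_sub_mul_gaussianReal (a : ℝ) {s : ℝ} (hs : 0 < s) :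
    ∫ z, max (a - s * z) 0 ∂gaussianReal 0 1
      = a * stdNormalCDF (a / s) + s * stdNormalPDF (a / s) := by
  have hid : Integrable (fun z : ℝ => z) (gaussianReal 0 1) := integrable_fun_id_gaussianReal 0 1
  have h1 : (fun z => max (a - s * z) 0) = (Set.Iic (a / s)).indicator fun z => a - s * z := by
    ext z
    by_cases hz : z ≤ a / s
    · have : s * z ≤ a := by rwa [le_div_iff₀ hs, mul_comm] at hz
      rw [Set.indicator_of_mem (by exact hz), max_eq_left (by linarith)]
    · have : a < s * z := by rwa [not_le, div_lt_iff₀ hs, mul_comm] at hz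
      rw [Set.indicator_of_notMem (by exact hz), max_eq_right (by linarith)]
  -- Since `φ' = -z φ`, the truncated first moment is a boundary term.
  have h2 : ∫ z in Set.Iic (a / s), z ∂gaussianReal 0 1 = -stdNormalPDF (a / s) := by
    have hint : Integrable (fun z => z * stdNormalPDF z) := by
      have := hid
      rw [gaussianReal_of_var_ne_zero _ one_ne_zero,
        integrable_withDensity_iff_integrable_smul' (measurable_gaussianPDF _ _)
          (ae_of_all _ fun _ => gaussianPDF_lt_top)] at this
      refine this.congr (ae_of_all _ fun z => ?_)
      simp [toReal_gaussianPDF, stdNormalPDF, mul_comm]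
    have := integral_Iic_of_hasDerivAt_of_tendsto' (a := a / s)
      (fun z _ => hasDerivAt_stdNormalPDF z) hint.neg.integrableOn tendsto_stdNormalPDF_atBot
    rw [gaussianReal_of_var_ne_zero _ one_ne_zero,
      setIntegral_withDensity_eq_setIntegral_toReal_smul (measurable_gaussianPDF _ _)
        (ae_of_all _ fun _ => gaussianPDF_lt_top) _ measurableSet_Iic]
    rw [integral_neg, sub_zero] at this
    rw [← this, neg_neg]
    refine integral_congr_ae (ae_of_all _ fun z => ?_)
    simp [toReal_gaussianPDF, stdNormalPDF, mul_comm]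
  rw [h1, integral_indicator measurableSet_Iic,
    integral_sub (integrable_const a).integrableOn (hid.const_mul s).integrableOn,
    integral_const_mul, h2, setIntegral_const, stdNormalCDF, cdf_eq_real, smul_eq_mul]
  ring

/-- The positive part is 1-Lipschitz. The bound does not depend on `a`, which is what lets `t` and
`x` vary together in the limit. -/
theorem abs_integral_max_sub_mul_sub_le (a : ℝ) {s : ℝ} (hs : 0 < s) :
    |(∫ z, max (a - s * z) 0 ∂gaussianReal 0 1) - max a 0|
      ≤ s * ∫ z, |z| ∂gaussianReal 0 1 := by
  have hid : Integrable (fun z : ℝ => z) (gaussianReal 0 1) := integrable_fun_id_gaussianReal 0 1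
  have h : max a 0 = ∫ z, max a 0 ∂gaussianReal 0 1 := by simp
  rw [h, ← integral_sub (integrable_max_sub_mul _ hid a s) (integrable_const _),
    ← integral_const_mul]
  refine (abs_integral_le_integral_abs).trans (integral_mono
    (((integrable_max_sub_mul _ hid a s).sub (integrable_const _)).abs) (hid.abs.const_mul s)
    fun z => ?_)
  refine (abs_max_sub_max_le_abs _ _ _).trans ?_
  simp [abs_mul, abs_of_pos hs]

/-- The put formula as a discounted Gaussian expectation. -/
theorem putFormula_eq_integral {r θ α K T t x : ℝ} (hθ : 0 < θ) (hα : 0 < α) (ht : t < T) :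
    putFormula r θ α K T t x = Real.exp (-(r * (T - t))) *
      ∫ z, max (K - x * Real.exp (r * (T - t)) - θ * √(T - t) / α * z) 0 ∂gaussianReal 0 1 := by
  have hq : 0 < √(T - t) := Real.sqrt_pos.2 (by linarith)
  rw [integral_max_sub_mul_gaussianReal _ (by positivity), putFormula, dLower]
  have e : α / (√(T - t) * θ) = (θ * √(T - t) / α)⁻¹ := by field_simp
  rw [e, ← div_eq_mul_inv, Real.exp_neg]
  have := Real.exp_ne_zero (r * (T - t))
  field_simp

theorem tendsto_putFormula {r θ α K T : ℝ} (hθ : 0 < θ) (hα : 0 < α) (x : ℝ) :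
    Tendsto (fun q : ℝ × ℝ => putFormula r θ α K T q.1 q.2)
      (𝓝[<] T ×ˢ 𝓝 x) (𝓝 (max (K - x) 0)) := by
  set C := ∫ z, |z| ∂gaussianReal 0 1
  set a : ℝ × ℝ → ℝ := fun q => K - q.2 * Real.exp (r * (T - q.1))
  set s : ℝ × ℝ → ℝ := fun q => θ * √(T - q.1) / α
  set I : ℝ × ℝ → ℝ := fun q => ∫ z, max (a q - s q * z) 0 ∂gaussianReal 0 1
  have hle : (𝓝[<] T ×ˢ 𝓝 x) ≤ 𝓝 (T, x) := by
    rw [nhds_prod_eq]; exact prod_mono nhdsWithin_le_nhds le_rfl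
  have hlt : ∀ᶠ q : ℝ × ℝ in 𝓝[<] T ×ˢ 𝓝 x, q.1 < T :=
    tendsto_fst.eventually (eventually_mem_nhdsWithin (s := Set.Iio T))
  have ha : Tendsto (fun q => max (a q) 0) (𝓝[<] T ×ˢ 𝓝 x) (𝓝 (max (K - x) 0)) := by
    have hc : Continuous fun q => max (a q) 0 := by fun_prop
    simpa [a] using (hc.tendsto (T, x)).mono_left hle
  have hs : Tendsto (fun q => s q * C) (𝓝[<] T ×ˢ 𝓝 x) (𝓝 0) := by
    have hc : Continuous fun q => s q * C := by fun_prop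
    simpa [s] using (hc.tendsto (T, x)).mono_left hle
  have hexp : Tendsto (fun q : ℝ × ℝ => Real.exp (-(r * (T - q.1)))) (𝓝[<] T ×ˢ 𝓝 x) (𝓝 1) := by
    have hc : Continuous fun q : ℝ × ℝ => Real.exp (-(r * (T - q.1))) := by fun_prop
    simpa using (hc.tendsto (T, x)).mono_left hle
  have hsub : Tendsto (fun q => I q - max (a q) 0) (𝓝[<] T ×ˢ 𝓝 x) (𝓝 0) := by
    refine squeeze_zero_norm' ?_ hs
    filter_upwards [hlt] with q hq
    have : 0 < √(T - q.1) := Real.sqrt_pos.2 (by linarith)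
    exact abs_integral_max_sub_mul_sub_le (a q) (by positivity)
  have hI : Tendsto I (𝓝[<] T ×ˢ 𝓝 x) (𝓝 (max (K - x) 0)) := by
    simpa using hsub.add ha
  have := hexp.mul hI
  rw [one_mul] at this
  refine this.congr' ?_
  filter_upwards [hlt] with q hq
  exact (putFormula_eq_integral hθ hα hq).symm

/-! ### Conditioning and independence. -/

variable {Ω : Type*} {m : MeasurableSpace Ω}

/-- Freezing lemma: a variable that is measurable for the conditioning σ-algebra is frozen, and a
variable that is independent of it is integrated out. -/
theorem condExp_comp_prod_of_indep {Ω : Type*} {G m : MeasurableSpace Ω}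
    {𝓧 𝓨 : Type*} [MeasurableSpace 𝓧] [MeasurableSpace 𝓨]
    {Q : Measure Ω} [IsProbabilityMeasure Q]
    (hG : G ≤ m) {X : Ω → 𝓧} {Y : Ω → 𝓨} (hX : Measurable[G] X) (hY : Measurable Y)
    (hXY : Indep (MeasurableSpace.comap Y inferInstance) G Q)
    {f : 𝓧 × 𝓨 → ℝ} (hf : StronglyMeasurable f)
    (hint : Integrable (fun ω => f (X ω, Y ω)) Q) :
    Q[fun ω => f (X ω, Y ω) | G] =ᵐ[Q] fun ω => ∫ y, f (X ω, y) ∂(Q.map Y) := by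
  have hXm : Measurable X := hX.mono hG le_rfl
  have hXYm : Measurable fun ω => (X ω, Y ω) := hXm.prodMk hY
  have : IsProbabilityMeasure (Q.map Y) := Measure.isProbabilityMeasure_map hY.aemeasurable
  have hg : StronglyMeasurable fun x => ∫ y, f (x, y) ∂(Q.map Y) := hf.integral_prod_right'
  -- Independence persists after restricting to a conditioning event: the joint law is a product on
  -- each `A` in `G`, so the defining identity of the conditional expectation is Fubini.
  have hmap : ∀ A, MeasurableSet[G] A → (Q.restrict A).map (fun ω => (X ω, Y ω))
      = ((Q.restrict A).map X).prod (Q.map Y) := by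
    intro A hA
    refine (Measure.prod_eq fun s t hs ht => ?_).symm
    rw [Measure.map_apply hXYm (hs.prod ht), Measure.map_apply hXm hs, Measure.map_apply hY ht,
      Measure.restrict_apply (hXYm (hs.prod ht)), Measure.restrict_apply (hXm hs)]
    have := (Indep_iff _ _ _).1 hXY (Y ⁻¹' t) (X ⁻¹' s ∩ A) ⟨t, ht, rfl⟩
      (@MeasurableSet.inter _ G _ _ (hX hs) hA)
    rw [mul_comm, ← this]
    congr 1
    ext ω
    simp only [Set.mem_inter_iff, Set.mem_preimage, Set.mem_prod]
    tauto
  have hintA : ∀ A, MeasurableSet[G] A →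
      Integrable f (((Q.restrict A).map X).prod (Q.map Y)) := by
    intro A hA
    rw [← hmap A hA, integrable_map_measure hf.aestronglyMeasurable hXYm.aemeasurable]
    exact hint.integrableOn
  refine (ae_eq_condExp_of_forall_setIntegral_eq hG hint ?_ ?_ ?_).symm
  · intro A hA _
    have := (hintA A hA).integral_prod_left
    rwa [integrable_map_measure hg.aestronglyMeasurable hXm.aemeasurable] at this
  · intro A hA _
    have h1 := integral_prod _ (hintA A hA)
    rw [← hmap A hA, integral_map hXYm.aemeasurable hf.aestronglyMeasurable,
      integral_map hXm.aemeasurable hg.aestronglyMeasurable] at h1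
    exact h1.symm
  · exact (hg.comp_measurable hX).aestronglyMeasurable

/-- Independence of a σ-algebra persists when that σ-algebra is enlarged by null sets. -/
theorem indep_sup_generateFrom_null {Ω : Type*} {m₁ m₂ m : MeasurableSpace Ω} {Q : Measure Ω}
    (h : Indep m₁ m₂ Q) {𝒩 : Set (Set Ω)} (h𝒩 : ∀ N ∈ 𝒩, Q N = 0) :
    Indep m₁ (m₂ ⊔ MeasurableSpace.generateFrom 𝒩) Q := by
  -- Every set of the enlarged σ-algebra agrees almost everywhere with a set of `m₂`; the added null
  -- sets agree with `∅`.
  have hle : m₂ ⊔ MeasurableSpace.generateFrom 𝒩 ≤ eventuallyMeasurableSpace m₂ (ae Q) := by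
    refine sup_le le_eventuallyMeasurableSpace (MeasurableSpace.generateFrom_le fun N hN => ?_)
    exact ⟨∅, @MeasurableSet.empty _ m₂, ae_eq_empty.2 (h𝒩 N hN)⟩
  rw [Indep_iff]
  intro A C hA hC
  obtain ⟨D, hD, hCD⟩ := hle C hC
  rw [measure_congr ((ae_eq_refl A).inter hCD), measure_congr hCD]
  exact (Indep_iff _ _ _).1 h A D hA hD

/-! ### Gaussian structure of Brownian motion on a bounded interval. -/

theorem IsBrownianOn.isGaussianProcess {B : ℝ≥0 → Ω → ℝ} {T : ℝ≥0} {Q : Measure Ω}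
    (hB : IsBrownianOn B T Q) :
    IsGaussianProcess (fun (t : Set.Iic T) ω => B t ω) Q where
  hasGaussianLaw I := by
    have h := (hB.hasLaw (I.map ⟨Subtype.val, Subtype.val_injective⟩) (by
      intro t ht
      obtain ⟨u, -, rfl⟩ := Finset.mem_map.1 ht
      exact u.2)).hasGaussianLaw
    let L : (I.map ⟨Subtype.val, Subtype.val_injective⟩ → ℝ) →L[ℝ] (I → ℝ) :=
      ContinuousLinearMap.pi fun i => ContinuousLinearMap.proj
        ⟨i.1.1, Finset.mem_map_of_mem ⟨Subtype.val, Subtype.val_injective⟩ i.2⟩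
    exact h.map L

theorem IsBrownianOn.hasLaw_eval {B : ℝ≥0 → Ω → ℝ} {T : ℝ≥0} {Q : Measure Ω}
    (hB : IsBrownianOn B T Q) {t : ℝ≥0} (ht : t ≤ T) : HasLaw (B t) (gaussianReal 0 t) Q :=
  (BrownianReal.measurePreserving_eval_projectiveFamily ⟨t, by simp⟩).hasLaw.comp
    (hB.hasLaw {t} (by simpa using ht))

theorem IsBrownianOn.hasLaw_sub {B : ℝ≥0 → Ω → ℝ} {T : ℝ≥0} {Q : Measure Ω}
    (hB : IsBrownianOn B T Q) {s t : ℝ≥0} (hst : s ≤ t) (ht : t ≤ T) :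
    HasLaw (fun ω => B t ω - B s ω) (gaussianReal 0 (t - s)) Q := by
  have h := (BrownianReal.measurePreserving_eval_sub_eval_projectiveFamily
    {t, s} ⟨t, by simp⟩ ⟨s, by simp⟩).hasLaw.comp (hB.hasLaw {t, s} (by
      simp [ht, hst.trans ht]))
  have e : nndist (t : ℝ) s = t - s := by
    ext
    rw [coe_nndist, Real.dist_eq, NNReal.coe_sub hst]
    exact abs_of_nonneg (sub_nonneg.2 hst)
  change HasLaw _ (gaussianReal 0 (nndist (t : ℝ) s)) Q at h
  rw [e] at h
  exact h

theorem IsBrownianOn.covariance_eval {B : ℝ≥0 → Ω → ℝ} {T : ℝ≥0} {Q : Measure Ω}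
    (hB : IsBrownianOn B T Q) {s t : ℝ≥0} (hs : s ≤ T) (ht : t ≤ T) :
    cov[fun ω => B s ω, fun ω => B t ω; Q] = min s t := by
  convert (hB.hasLaw {s, t} (by simp [hs, ht])).covariance_fun_comp
    (f := Function.eval ⟨s, by simp⟩) (g := fun x ↦ x ⟨t, by simp⟩) ?_ ?_
  · simp
  · simp
  · rw [BrownianReal.covariance_eval_projectiveFamily]
  all_goals exact Measurable.aemeasurable (by fun_prop)

/-- The increments of a Brownian motion on `[0, T]` are independent of its past. -/
theorem IsBrownianOn.indepFun_sub {B : ℝ≥0 → Ω → ℝ} {T : ℝ≥0} {Q : Measure Ω}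
    (hB : IsBrownianOn B T Q) {s t : ℝ≥0} (hst : s ≤ t) (ht : t ≤ T) :
    IndepFun (fun ω => B t ω - B s ω) (fun ω (u : Set.Iic s) => B u ω) Q := by
  have hG := hB.isGaussianProcess
  have hsT := hst.trans ht
  have hLp : ∀ u ≤ T, MemLp (fun ω => B u ω) 2 Q := fun u hu =>
    (hG.hasGaussianLaw_eval ⟨u, hu⟩).memLp_two
  have := hG.isProbabilityMeasure
  -- Jointly Gaussian and uncorrelated families are independent; the increment is viewed as a
  -- process indexed by `Unit` to fit that criterion.
  have key : IndepFun (fun ω (_ : Unit) => B t ω - B s ω) (fun ω (u : Set.Iic s) => B u ω) Q := by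
    refine IsGaussianProcess.indepFun_of_covariance_eq_zero (X := fun (_ : Unit) ω => B t ω - B s ω)
      (Y := fun (u : Set.Iic s) ω => B u ω) ?_ ?_ ?_ ?_
    · refine hG.of_isGaussianProcess ?_
      rintro (_ | ⟨u, hu⟩)
      · refine ⟨{⟨t, ht⟩, ⟨s, hsT⟩}, ContinuousLinearMap.proj ⟨⟨t, ht⟩, by simp⟩
          - ContinuousLinearMap.proj ⟨⟨s, hsT⟩, by simp⟩, fun ω => ?_⟩
        simp
      · exact ⟨{⟨u, le_trans hu hsT⟩}, ContinuousLinearMap.proj ⟨⟨u, le_trans hu hsT⟩, by simp⟩,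
          fun ω => by simp⟩
    · exact fun _ => ((hLp t ht).sub (hLp s hsT)).aestronglyMeasurable.aemeasurable
    · exact fun u => (hLp u (le_trans u.2 hsT)).aestronglyMeasurable.aemeasurable
    · rintro _ ⟨u, hu : u ≤ s⟩
      have huT := hu.trans hsT
      rw [covariance_fun_sub_left (hLp t ht) (hLp s hsT) (hLp u huT), hB.covariance_eval ht huT,
        hB.covariance_eval hsT huT, min_eq_right hu, min_eq_right (hu.trans hst), sub_self]
  exact key.comp (φ := fun x : Unit → ℝ => x ()) (measurable_pi_apply _) measurable_id

/-- Under a measure that does not charge the `P`-null sets, the increments of `W_t + c t` are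
independent of the augmented filtration of `W` as soon as `W_t + c t` is a Brownian motion. -/
theorem indep_brownianFiltration {P : Measure Ω} [P.IsComplete] {W : ℝ≥0 → Ω → ℝ}
    (hWm : ∀ t, Measurable (W t)) {Q : Measure Ω} (hQP : Q ≪ P) {c : ℝ} {T : ℝ≥0}
    (hB : IsBrownianOn (fun t ω => W t ω + c * t) T Q) {s t : ℝ≥0} (hst : s ≤ t) (ht : t ≤ T) :
    Indep (MeasurableSpace.comap (fun ω => (W t ω + c * t) - (W s ω + c * s)) inferInstance)
      (brownianFiltration P W hWm s) Q := by
  have h := hB.indepFun_sub hst ht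
  rw [IndepFun_iff_Indep] at h
  refine indep_sup_generateFrom_null (indep_of_indep_of_le_right h ?_) fun N hN => hQP hN
  refine iSup₂_le fun u hu => ?_
  -- The drift is deterministic, so `W u` is a measurable function of the drifted path up to `s`.
  let φ : (Set.Iic s → ℝ) → ℝ := fun x => x ⟨u, hu⟩ - c * u
  have hφ : Measurable φ := (measurable_pi_apply _).sub_const _
  have e : W u = φ ∘ fun ω (v : Set.Iic s) => W v ω + c * v := by
    ext ω; simp [φ]
  rw [e, ← MeasurableSpace.comap_comp]
  exact MeasurableSpace.comap_mono hφ.comap_le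

theorem measurable_brownianFiltration {P : Measure Ω} [P.IsComplete] {W : ℝ≥0 → Ω → ℝ}
    (hWm : ∀ t, Measurable (W t)) (t : ℝ≥0) : Measurable[brownianFiltration P W hWm t] (W t) := by
  rw [measurable_iff_comap_le]
  exact le_sup_of_le_left (le_iSup₂_of_le t le_rfl le_rfl)

/-! ### Cameron-Martin formula and the Girsanov measure. -/

/-- Exponential tilting of a centred Gaussian law shifts its mean. -/
theorem lintegral_exp_mul_comp_add_gaussianReal (θ : ℝ) {v : ℝ≥0} (hv : v ≠ 0)
    {k : ℝ → ENNReal} (hk : Measurable k) :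
    ∫⁻ z, ENNReal.ofReal (Real.exp (-(θ * z) - θ ^ 2 * v / 2)) * k (z + θ * v) ∂gaussianReal 0 v
      = ∫⁻ z, k z ∂gaussianReal 0 v := by
  rw [gaussianReal_of_var_ne_zero _ hv,
    lintegral_withDensity_eq_lintegral_mul _ (measurable_gaussianPDF _ _) (by fun_prop),
    lintegral_withDensity_eq_lintegral_mul _ (measurable_gaussianPDF _ _) hk,
    -- Translation invariance of Lebesgue measure aligns the arguments of `k`; completing the square
    -- then matches the densities.
    ← lintegral_add_right_eq_self (gaussianPDF 0 v * k) (θ * v)]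
  refine lintegral_congr fun z => ?_
  simp only [Pi.mul_apply]
  rw [← mul_assoc]
  congr 1
  rw [gaussianPDF, gaussianPDF, ← ENNReal.ofReal_mul (gaussianPDFReal_nonneg _ _ _)]
  congr 1
  rw [gaussianPDFReal, gaussianPDFReal, mul_assoc, ← Real.exp_add]
  congr 2
  have : (v : ℝ) ≠ 0 := by exact_mod_cast hv
  field_simp
  ring

theorem IsBrownianOn.of_isBrownianReal {W : ℝ≥0 → Ω → ℝ} {P : Measure Ω}
    (hW : IsBrownianReal W P) (T : ℝ≥0) : IsBrownianOn W T P where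
  hasLaw I _ := hW.hasLaw I
  cont := hW.cont.mono fun _ h => h.continuousOn

/-- The Brownian bridge is independent of the terminal value of the Brownian motion. -/
theorem IsBrownianOn.indepFun_bridge {W : ℝ≥0 → Ω → ℝ} {T : ℝ≥0} {P : Measure Ω}
    (hW : IsBrownianOn W T P) (hT : 0 < T) (I : Finset ℝ≥0) (hI : ∀ t ∈ I, t ≤ T) :
    IndepFun (fun ω (t : I) => W t ω - t / T * W T ω) (W T) P := by
  have hG := hW.isGaussianProcess
  have hLp : ∀ u ≤ T, MemLp (fun ω => W u ω) 2 P := fun u hu =>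
    (hG.hasGaussianLaw_eval ⟨u, hu⟩).memLp_two
  have := hG.isProbabilityMeasure
  have hTm : MemLp (fun ω => W T ω) 2 P := hLp T le_rfl
  have key : IndepFun (fun ω (t : I) => W t ω - t / T * W T ω) (fun ω (_ : Unit) => W T ω) P := by
    refine IsGaussianProcess.indepFun_of_covariance_eq_zero
      (X := fun (t : I) ω => W t ω - t / T * W T ω) (Y := fun (_ : Unit) ω => W T ω) ?_ ?_ ?_ ?_
    · refine hG.of_isGaussianProcess ?_
      rintro (⟨t, ht⟩ | _)
      · refine ⟨{⟨t, hI t ht⟩, ⟨T, Set.mem_Iic.2 le_rfl⟩},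
          ContinuousLinearMap.proj ⟨⟨t, hI t ht⟩, by simp⟩
          - ((t : ℝ) / T) • ContinuousLinearMap.proj ⟨⟨T, Set.mem_Iic.2 le_rfl⟩, by simp⟩,
          fun ω => ?_⟩
        simp
      · exact ⟨{⟨T, Set.mem_Iic.2 le_rfl⟩},
          ContinuousLinearMap.proj ⟨⟨T, Set.mem_Iic.2 le_rfl⟩, by simp⟩, fun ω => by simp⟩
    · exact fun t => ((hLp t (hI t t.2)).sub
        (hTm.const_mul _)).aestronglyMeasurable.aemeasurable
    · exact fun _ => hTm.aestronglyMeasurable.aemeasurable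
    · rintro ⟨t, ht⟩ _
      have h0 : (T : ℝ) ≠ 0 := by exact_mod_cast hT.ne'
      rw [covariance_fun_sub_left (hLp t (hI t ht)) (hTm.const_mul _) hTm,
        covariance_const_mul_left, hW.covariance_eval (hI t ht) le_rfl,
        hW.covariance_eval le_rfl le_rfl, min_self, min_eq_left (hI t ht)]
      -- The covariance is `t - (t/T) T = 0`.
      field_simp
      simp
  exact key.comp (φ := id) (ψ := fun x : Unit → ℝ => x ()) measurable_id (measurable_pi_apply _)

/-- The Cameron-Martin formula for the finite-dimensional laws of Brownian motion. -/
theorem IsBrownianOn.lintegral_exp_mul_restrict_add {W : ℝ≥0 → Ω → ℝ} {T : ℝ≥0} {P : Measure Ω}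
    (hW : IsBrownianOn W T P) (hWm : ∀ t, Measurable (W t)) (hT : 0 < T) (θ : ℝ)
    (I : Finset ℝ≥0) (hI : ∀ t ∈ I, t ≤ T) {h : (I → ℝ) → ENNReal} (hh : Measurable h) :
    ∫⁻ ω, ENNReal.ofReal (Real.exp (-(θ * W T ω) - θ ^ 2 * T / 2))
        * h (I.restrict fun t => W t ω + θ * t) ∂P
      = ∫⁻ ω, h (I.restrict fun t => W t ω) ∂P := by
  have := hW.isGaussianProcess.isProbabilityMeasure
  have h0 : (T : ℝ) ≠ 0 := by exact_mod_cast hT.ne'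
  set Y : Ω → I → ℝ := fun ω t => W t ω - t / T * W T ω
  have hY : Measurable Y := measurable_pi_lambda _ fun t => (hWm t).sub ((hWm T).const_mul _)
  have hYZ : Measurable fun ω => (Y ω, W T ω) := hY.prodMk (hWm T)
  have hlaw : P.map (fun ω => (Y ω, W T ω)) = (P.map Y).prod (gaussianReal 0 T) := by
    rw [(indepFun_iff_map_prod_eq_prod_map_map hY.aemeasurable (hWm T).aemeasurable).1
      (hW.indepFun_bridge hT I hI), (hW.hasLaw_eval le_rfl).map_eq]
  let k : (I → ℝ) × ℝ → ENNReal := fun p => h fun t => p.1 t + t / T * p.2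
  have hk : Measurable k := hh.comp (by fun_prop)
  -- In the coordinates (bridge, terminal value), both the weight and the drift act on the second
  -- coordinate only.
  let g : (I → ℝ) × ℝ → ENNReal := fun p =>
    ENNReal.ofReal (Real.exp (-(θ * p.2) - θ ^ 2 * T / 2)) * k (p.1, p.2 + θ * T)
  have hg : Measurable g := by
    refine Measurable.mul (by fun_prop) (hk.comp (by fun_prop))
  calc ∫⁻ ω, ENNReal.ofReal (Real.exp (-(θ * W T ω) - θ ^ 2 * T / 2))
        * h (I.restrict fun t => W t ω + θ * t) ∂P
      = ∫⁻ ω, g (Y ω, W T ω) ∂P := by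
        refine lintegral_congr fun ω => ?_
        simp only [g, k]
        congr 2
        ext t
        simp only [Finset.restrict, Y]
        field_simp
        ring
    _ = ∫⁻ ω, k (Y ω, W T ω) ∂P := by
        rw [← lintegral_map hg hYZ, ← lintegral_map hk hYZ, hlaw,
          lintegral_prod _ hg.aemeasurable, lintegral_prod _ hk.aemeasurable]
        refine lintegral_congr fun y => ?_
        exact lintegral_exp_mul_comp_add_gaussianReal θ hT.ne' (k := fun z => k (y, z))
          (hk.comp measurable_prodMk_left)
    _ = ∫⁻ ω, h (I.restrict fun t => W t ω) ∂P := by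
        refine lintegral_congr fun ω => ?_
        simp only [k]
        congr 1
        ext t
        simp only [Finset.restrict, Y]
        ring

/-- The Girsanov measure for the constant drift `θ` on `[0, T]`. -/
noncomputable def girsanovMeasure (P : Measure Ω) (W : ℝ≥0 → Ω → ℝ) (θ : ℝ) (T : ℝ≥0) :
    Measure Ω :=
  P.withDensity fun ω => ENNReal.ofReal (Real.exp (-(θ * W T ω) - θ ^ 2 * T / 2))

theorem isBrownianOn_girsanovMeasure {P : Measure Ω} {W : ℝ≥0 → Ω → ℝ}
    (hWm : ∀ t, Measurable (W t)) (hW : IsBrownianReal W P) (θ : ℝ) {T : ℝ≥0} (hT : 0 < T) :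
    IsBrownianOn (fun t ω => W t ω + θ * t) T (girsanovMeasure P W θ T) where
  hasLaw I hI := by
    have hm : Measurable fun ω => I.restrict fun t => W t ω + θ * t :=
      measurable_pi_lambda _ fun t => (hWm t).add_const _
    have hm' : Measurable fun ω => I.restrict fun t => W t ω :=
      measurable_pi_lambda _ fun t => hWm t
    refine ⟨hm.aemeasurable, ?_⟩
    rw [← (hW.hasLaw I).map_eq]
    refine Measure.ext_of_lintegral _ fun h hh => ?_
    have hT' := hWm T
    rw [lintegral_map hh hm, lintegral_map hh hm', girsanovMeasure,
      lintegral_withDensity_eq_lintegral_mul _ (by fun_prop)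
        (show Measurable fun ω => h (I.restrict fun t => W t ω + θ * t) from hh.comp hm),
      ← (IsBrownianOn.of_isBrownianReal hW T).lintegral_exp_mul_restrict_add hWm hT θ I hI hh]
    rfl
  cont := by
    refine (withDensity_absolutelyContinuous _ _).ae_le ?_
    filter_upwards [hW.cont] with ω hω
    exact (hω.add (by fun_prop)).continuousOn

/-- Conditional expectation, given the augmented filtration of `W`, of a function of `W_s` and the
increment `B_t - B_s` of a Brownian motion `B_t = W_t + c t`. -/
theorem condExp_brownianFiltration {P : Measure Ω} [P.IsComplete] {W : ℝ≥0 → Ω → ℝ}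
    (hWm : ∀ t, Measurable (W t)) {Q : Measure Ω} [IsProbabilityMeasure Q] (hQP : Q ≪ P) {c : ℝ}
    {T : ℝ≥0} (hB : IsBrownianOn (fun t ω => W t ω + c * t) T Q) {s t : ℝ≥0} (hst : s ≤ t)
    (ht : t ≤ T) {f : ℝ × ℝ → ℝ} (hf : StronglyMeasurable f)
    (hint : Integrable (fun ω => f (W s ω, (W t ω + c * t) - (W s ω + c * s))) Q) :
    Q[fun ω => f (W s ω, (W t ω + c * t) - (W s ω + c * s)) | brownianFiltration P W hWm s]
      =ᵐ[Q] fun ω => ∫ y, f (W s ω, y) ∂gaussianReal 0 (t - s) := by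
  have h := condExp_comp_prod_of_indep ((brownianFiltration P W hWm).le s)
    (measurable_brownianFiltration hWm s)
    (show Measurable fun ω => (W t ω + c * t) - (W s ω + c * s) from
      ((hWm t).add_const _).sub ((hWm s).add_const _))
    (indep_brownianFiltration hWm hQP hB hst ht) hf hint
  rwa [(hB.hasLaw_sub hst ht).map_eq] at h

theorem isRiskNeutral_girsanovMeasure {P : Measure Ω} [P.IsComplete] {W : ℝ≥0 → Ω → ℝ}
    (hWm : ∀ t, Measurable (W t)) (hW : IsBrownianReal W P) {r μ σ : ℝ} (hσ : 0 < σ)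
    {T : ℝ≥0} (hT : 0 < T) :
    IsRiskNeutral P (brownianFiltration P W hWm) W r μ σ T
      (girsanovMeasure P W (marketPriceOfRisk r μ σ) T) := by
  set θ := marketPriceOfRisk r μ σ with hθ
  set Q := girsanovMeasure P W θ T with hQ
  have hB : IsBrownianOn (fun t ω => W t ω + θ * t) T Q :=
    isBrownianOn_girsanovMeasure hWm hW θ hT
  have hQP : Q ≪ P := withDensity_absolutelyContinuous _ _
  -- The Gaussian laws under `Q` already force total mass one, so the density need not be
  -- integrated.
  have hQ1 : IsProbabilityMeasure Q := hB.isGaussianProcess.isProbabilityMeasure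
  have hσθ : σ * θ = μ - r := by rw [hθ, marketPriceOfRisk]; field_simp
  -- In terms of `B_t = W_t + θ t`, the discounted stock is the exponential martingale `exp (σ B_t -
  -- σ² t / 2)`.
  have hM : ∀ (t : ℝ≥0) ω, Real.exp (-(r * t)) * stock W μ σ t ω
      = Real.exp (-(σ ^ 2 * t / 2)) * Real.exp (σ * (W t ω + θ * t)) := by
    intro t ω
    rw [stock, ← Real.exp_add, ← Real.exp_add]
    congr 1
    linear_combination (-(t : ℝ)) * hσθ
  have hint : ∀ t ≤ T, Integrable (fun ω => Real.exp (-(r * t)) * stock W μ σ t ω) Q := by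
    intro t ht
    simp_rw [hM]
    have hl := hB.hasLaw_eval ht
    have := integrable_exp_mul_gaussianReal (μ := 0) (v := t) σ
    rw [← hl.map_eq, integrable_map_measure (by fun_prop) hl.aemeasurable] at this
    exact this.const_mul _
  refine ⟨hQ1, hQP, ?_, hB, ?_, hint, ?_⟩
  · have hT' := hWm T
    exact withDensity_absolutelyContinuous' (by fun_prop)
      (ae_of_all _ fun ω => (ENNReal.ofReal_pos.2 (Real.exp_pos _)).ne')
  · intro t _
    have := measurable_brownianFiltration (P := P) hWm t
    refine Measurable.stronglyMeasurable ?_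
    unfold stock
    exact (Real.measurable_exp.comp ((this.const_mul σ).const_add _)).const_mul _
  · intro s t hst ht
    let f : ℝ × ℝ → ℝ := fun p =>
      Real.exp (-(σ ^ 2 * t / 2)) * (Real.exp (σ * (p.1 + θ * s)) * Real.exp (σ * p.2))
    have hf : StronglyMeasurable f := by
      have : Continuous f := by fun_prop
      exact this.stronglyMeasurable
    have e : (fun ω => Real.exp (-(r * t)) * stock W μ σ t ω)
        = fun ω => f (W s ω, (W t ω + θ * t) - (W s ω + θ * s)) := by
      ext ω
      simp only [f]
      rw [hM, ← Real.exp_add (σ * _)]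
      ring_nf
    have h := condExp_brownianFiltration hWm hQP hB hst ht hf (by rw [← e]; exact hint t ht)
    rw [← e] at h
    refine h.trans (ae_of_all _ fun ω => ?_)
    have hmgf : ∫ y, Real.exp (σ * y) ∂gaussianReal 0 (t - s)
        = Real.exp ((t - s) * σ ^ 2 / 2) := by
      have := congrFun (mgf_id_gaussianReal (μ := 0) (v := t - s)) σ
      simpa [mgf, NNReal.coe_sub hst] using this
    simp only [f]
    rw [hM, integral_const_mul, integral_const_mul, hmgf, ← Real.exp_add, ← Real.exp_add,
      ← Real.exp_add]
    congr 1
    ring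

/-! ### Pricing the put. -/

theorem integral_comp_const_mul_gaussianReal {g : ℝ → ℝ} (hg : Measurable g) (v : ℝ≥0) :
    ∫ y, g y ∂gaussianReal 0 v = ∫ z, g (√v * z) ∂gaussianReal 0 1 := by
  have h := gaussianReal_map_const_mul (μ := 0) (v := 1) (√(v : ℝ))
  have e : (⟨√(v : ℝ) ^ 2, sq_nonneg _⟩ : ℝ≥0) * 1 = v := by
    ext; simp
  rw [mul_zero, show NNReal.mk (√(v : ℝ) ^ 2) (sq_nonneg _) * 1 = v from e] at h
  rw [← h, integral_map (by fun_prop) hg.aestronglyMeasurable]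

/-- Discounted wealth is affine in `W_t + θ t`, so over `[t, T]` wealth compounds at rate `r` and
gains a multiple of the increment. -/
theorem shadowWealth_terminal (W : ℝ≥0 → Ω → ℝ) (r θ α x₀ : ℝ) (T t : ℝ≥0) (ω : Ω) :
    shadowWealth W r θ α x₀ T T ω
      = shadowWealth W r θ α x₀ T t ω * Real.exp (r * (T - t))
        + θ / α * ((W T ω + θ * T) - (W t ω + θ * t)) := by
  have h1 : Real.exp (r * T) = Real.exp (r * t) * Real.exp (r * (T - t)) := by
    rw [← Real.exp_add]; ring_nf
  have h2 : Real.exp (r * (t - T)) * Real.exp (r * (T - t)) = 1 := by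
    rw [← Real.exp_add, ← Real.exp_zero]; ring_nf
  simp only [shadowWealth, sub_self, mul_zero, Real.exp_zero, mul_one]
  linear_combination x₀ * h1 - (t * (θ ^ 2 / α) + θ / α * W t ω) * h2

theorem integrable_putPayoff {Q : Measure Ω} [IsProbabilityMeasure Q] {W : ℝ≥0 → Ω → ℝ}
    {r θ : ℝ} {T : ℝ≥0} (hB : IsBrownianOn (fun t ω => W t ω + θ * t) T Q) (α x₀ K : ℝ) :
    Integrable (putPayoff (shadowWealth W r θ α x₀ T) K T) Q := by
  have h0 : Integrable (fun ω => W T ω + θ * T) Q :=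
    (hB.isGaussianProcess.hasGaussianLaw_eval ⟨T, Set.mem_Iic.2 le_rfl⟩).integrable
  have e : shadowWealth W r θ α x₀ T T
      = fun ω => x₀ * Real.exp (r * T) + θ / α * (W T ω + θ * T) := by
    ext ω
    simp only [shadowWealth, sub_self, mul_zero, Real.exp_zero, mul_one]
    ring
  have h1 : Integrable (shadowWealth W r θ α x₀ T T) Q := by
    rw [e]; exact (integrable_const _).add (h0.const_mul _)
  exact ((integrable_const K).sub h1).pos_part

theorem riskNeutralPrice_putPayoff {P : Measure Ω} [P.IsComplete] {W : ℝ≥0 → Ω → ℝ}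
    (hWm : ∀ t, Measurable (W t)) {Q : Measure Ω} [IsProbabilityMeasure Q] (hQP : Q ≪ P)
    {r θ α : ℝ} (hθ : 0 < θ) (hα : 0 < α) (x₀ K : ℝ) {T : ℝ≥0}
    (hB : IsBrownianOn (fun t ω => W t ω + θ * t) T Q) {t : ℝ≥0} (ht : t < T) :
    ∀ᵐ ω ∂Q, riskNeutralPrice Q (brownianFiltration P W hWm) r T
        (putPayoff (shadowWealth W r θ α x₀ T) K T) t ω
      = putFormula r θ α K T t (shadowWealth W r θ α x₀ T t ω) := by
  let x : ℝ → ℝ := fun w => x₀ * Real.exp (r * t) + t * (θ ^ 2 / α) * Real.exp (r * (t - T))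
    + θ / α * Real.exp (r * (t - T)) * w
  let f : ℝ × ℝ → ℝ := fun p => max (K - x p.1 * Real.exp (r * (T - t)) - θ / α * p.2) 0
  have hf : StronglyMeasurable f := by
    have : Continuous f := by fun_prop
    exact this.stronglyMeasurable
  have e : putPayoff (shadowWealth W r θ α x₀ T) K T
      = fun ω => f (W t ω, (W T ω + θ * T) - (W t ω + θ * t)) := by
    ext ω
    rw [putPayoff, shadowWealth_terminal W r θ α x₀ T t ω, ← sub_sub]
    rfl
  have hint := integrable_putPayoff (r := r) hB α x₀ K
  have h := condExp_brownianFiltration hWm hQP hB ht.le le_rfl hf (by rw [← e]; exact hint)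
  rw [← e] at h
  filter_upwards [h] with ω hω
  rw [riskNeutralPrice, hω, putFormula_eq_integral hθ hα (by exact_mod_cast ht),
    integral_comp_const_mul_gaussianReal
      (g := fun y => f (W t ω, y)) (hf.measurable.comp measurable_prodMk_left),
    NNReal.coe_sub ht.le]
  congr 1
  refine integral_congr_ae (ae_of_all _ fun z => ?_)
  simp only [f, x, shadowWealth]
  congr 2
  ring

/-- The payoff is `F_T`-measurable, so conditioning returns it unchanged, here even for every `ω`.
-/
theorem riskNeutralPrice_terminal {P : Measure Ω} [P.IsComplete] {W : ℝ≥0 → Ω → ℝ}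
    (hWm : ∀ t, Measurable (W t)) {Q : Measure Ω} [IsProbabilityMeasure Q]
    {r θ : ℝ} (α x₀ K : ℝ) {T : ℝ≥0}
    (hB : IsBrownianOn (fun t ω => W t ω + θ * t) T Q) (ω : Ω) :
    riskNeutralPrice Q (brownianFiltration P W hWm) r T
        (putPayoff (shadowWealth W r θ α x₀ T) K T) T ω
      = max (K - shadowWealth W r θ α x₀ T T ω) 0 := by
  have hm := measurable_brownianFiltration (P := P) hWm T
  have hsm : StronglyMeasurable[brownianFiltration P W hWm T]
      (putPayoff (shadowWealth W r θ α x₀ T) K T) := by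
    refine Measurable.stronglyMeasurable ?_
    unfold putPayoff shadowWealth
    exact (((hm.const_mul _).const_add _).const_sub K).max measurable_const
  rw [riskNeutralPrice, condExp_of_stronglyMeasurable ((brownianFiltration P W hWm).le T) hsm
    (integrable_putPayoff hB α x₀ K)]
  simp [putPayoff]

end ShadowPut

theorem proposition5 {Ω : Type*} {m : MeasurableSpace Ω} (P : Measure Ω)
    [IsProbabilityMeasure P] [P.IsComplete]
    (W : ℝ≥0 → Ω → ℝ) (hWm : ∀ t, Measurable (W t)) (hW : IsBrownianReal W P)
    (r μ σ α x₀ K : ℝ) (T : ℝ≥0)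
    (hσ : 0 < σ) (hμ : r < μ) (hα : 0 < α) (hT : 0 < T)
    (F : Filtration ℝ≥0 m) (hF : F = ShadowPut.brownianFiltration P W hWm)
    (θ : ℝ) (hθ : θ = ShadowPut.marketPriceOfRisk r μ σ)
    (X : ℝ≥0 → Ω → ℝ) (hX : X = ShadowPut.shadowWealth W r θ α x₀ T) :
    (∃ Q : Measure Ω, ShadowPut.IsRiskNeutral P F W r μ σ T Q) ∧
    (∀ Q : Measure Ω, ShadowPut.IsRiskNeutral P F W r μ σ T Q →
      Integrable (ShadowPut.putPayoff X K T) Q ∧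
      (∀ t : ℝ≥0, t < T →
        ∀ᵐ ω ∂P, ShadowPut.riskNeutralPrice Q F r T (ShadowPut.putPayoff X K T) t ω
          = ShadowPut.putFormula r θ α K T t (X t ω)) ∧
      (∀ᵐ ω ∂P, ShadowPut.riskNeutralPrice Q F r T (ShadowPut.putPayoff X K T) T ω
          = max (K - X T ω) 0)) ∧
    (∀ x : ℝ, Tendsto (fun q : ℝ × ℝ => ShadowPut.putFormula r θ α K T q.1 q.2)
      (𝓝[<] (T : ℝ) ×ˢ 𝓝 x) (𝓝 (max (K - x) 0))) := by
  subst hF hX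
  have hθ0 : 0 < θ := by
    rw [hθ, ShadowPut.marketPriceOfRisk]
    exact div_pos (sub_pos.2 hμ) hσ
  refine ⟨⟨_, ShadowPut.isRiskNeutral_girsanovMeasure hWm hW hσ hT⟩, fun Q hQ => ?_,
    fun x => ShadowPut.tendsto_putFormula hθ0 hα x⟩
  have := hQ.isProbabilityMeasure
  have hB := hQ.isBrownianOn
  rw [← hθ] at hB
  exact ⟨ShadowPut.integrable_putPayoff hB α x₀ K,
    -- The formula holds `Q`-almost surely; `P ≪ Q` carries it over to `P`.
    fun t ht => hQ.ac_symm.ae_le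
      (ShadowPut.riskNeutralPrice_putPayoff hWm hQ.ac hθ0 hα x₀ K hB ht),
    ae_of_all _ fun ω => ShadowPut.riskNeutralPrice_terminal hWm α x₀ K hB ω⟩
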